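/- Let $n\ge 5$ and let $\pi=(d_1,d_2,\dots,d_n)$ be a non-increasing sequence of positive integers that is graphic, i.e. the degree sequence of a simple graph of order $n$. Let $K_5-P_3$ denote the graph obtained from the complete graph on five vertices by removing the three edges of a path on four of these vertices. Say that $\pi$ is potentially $K_5-P_3$-graphic if some simple graph with degree sequence $\pi$ contains $K_5-P_3$ as a (not necessarily induced) subgraph. Then $\pi$ is potentially $K_5-P_3$-graphic if and only if the following two conditions hold: (1) $d_1\ge 4$, $d_3\ge 3$ and $d_5\ge 2$; (2) $\pi$ is none of the sequences $(4,3,3,2,2,2)$, $(4,3,3,2,2,2,2)$, $(4,3,3,3,3,3,3)$. -/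

import Mathlib

open Classical in
/-- `IsRealization G d`: the graph `G` on the vertices `0, …, n - 1` realizes the sequence `d`,
i.e. the vertices can be listed so that the `i`-th one has degree `d i`. -/
def IsRealization {n : ℕ} (G : SimpleGraph (Fin n)) (d : Fin n → ℕ) : Prop :=
  ∃ σ : Equiv.Perm (Fin n), ∀ i, G.degree (σ i) = d i

/-- A graphic sequence: a non-increasing sequence of `n` nonnegative integers that is the degree
sequence of a simple graph of order `n`. -/
def IsGraphic {n : ℕ} (d : Fin n → ℕ) : Prop :=
  Antitone d ∧ ∃ G : SimpleGraph (Fin n), IsRealization G d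

/-- `d` has a realization that contains `H` as a (not necessarily induced) subgraph. -/
def PotentiallyGraphic {V : Type*} (H : SimpleGraph V) {n : ℕ} (d : Fin n → ℕ) : Prop :=
  ∃ G : SimpleGraph (Fin n), IsRealization G d ∧ H.IsContained G

/-- The path `P_k` with `k` edges, on `k + 1` vertices. -/
def pathWithEdges (k : ℕ) : SimpleGraph (Fin (k + 1)) :=
  SimpleGraph.pathGraph (k + 1)

/-- The graph `K_5 - P_3`: the complete graph on five vertices with the three edges of a path on
four of these vertices removed. -/
def K5MinusP3 : SimpleGraph (Fin 5) :=
  (⊤ : SimpleGraph (Fin 5)).deleteEdges ((pathWithEdges 3).map Fin.castSuccEmb).edgeSet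

/-
Both conditions are necessary: a copy of `K_5 - P_3` forces its degree sequence `(4, 3, 3, 2, 2)`
entrywise, and each of the three excluded sequences has too small a sum for a copy together with
the edges at the remaining vertices.

Conversely, remove from a realization a vertex of minimum degree, after switching edges so that its
neighbors have the largest degrees possible (Havel–Hakimi). If the remaining sequence still
dominates `(4, 3, 3, 2, 2)`, induction gives a copy to which the vertex is adjoined again; should
the remaining sequence be an excluded one, it is the sequence of a suitable graph with surplus twos
or threes, which are put back after adjoining the vertex by subdividing edges outside the copy.
If the remaining sequence does not dominate `(4, 3, 3, 2, 2)`, the original one either has all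
entries at most `4`, with at most three fours unless it is that of `K_5`, or consists of one large
entry, two threes and twos. Such sequences are realized explicitly, by enlarging subgraphs of `K_5`
that contain `K_5 - P_3`.
-/

open SimpleGraph

section Degrees

variable {V W : Type*}

/-- The degree of a vertex as the cardinality of its set of neighbors, free of decidability
instances. -/
noncomputable def vertexDegree (G : SimpleGraph V) (v : V) : ℕ :=
  (G.neighborSet v).ncard

/-- The degree sequence of a finite graph, as a multiset. -/
noncomputable def degreeMultiset [Fintype V] (G : SimpleGraph V) : Multiset ℕ :=
  Finset.univ.val.map (vertexDegree G)

theorem vertexDegree_eq_degree (G : SimpleGraph V) (v : V) [Fintype (G.neighborSet v)] :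
    vertexDegree G v = G.degree v := by
  rw [vertexDegree, Set.ncard_eq_toFinset_card', SimpleGraph.degree, SimpleGraph.neighborFinset]

theorem vertexDegree_iso {G : SimpleGraph V} {G' : SimpleGraph W} (e : G ≃g G') (v : V) :
    vertexDegree G' (e v) = vertexDegree G v :=
  (Set.ncard_congr' (e.mapNeighborSet v)).symm

theorem degreeMultiset_congr [Fintype V] [Fintype W] {G : SimpleGraph V} {G' : SimpleGraph W}
    (e : G ≃g G') : degreeMultiset G = degreeMultiset G' := by
  rw [degreeMultiset, degreeMultiset, ← Multiset.map_univ_val_equiv e.toEquiv, Multiset.map_map]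
  exact Multiset.map_congr rfl fun v _ => (vertexDegree_iso e v).symm

theorem card_degreeMultiset [Fintype V] (G : SimpleGraph V) :
    (degreeMultiset G).card = Fintype.card V :=
  Multiset.card_map _ _

theorem sum_degreeMultiset [Fintype V] (G : SimpleGraph V) :
    (degreeMultiset G).sum = 2 * G.edgeSet.ncard := by
  classical
  rw [Set.ncard_eq_toFinset_card', Set.toFinset_card, ← SimpleGraph.edgeFinset_card,
    ← G.sum_degrees_eq_twice_card_edges]
  exact Finset.sum_congr rfl fun v _ => vertexDegree_eq_degree G v

theorem vertexDegree_deleteEdges_singleton [Finite V] [DecidableEq V] {G : SimpleGraph V}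
    {e : Sym2 V} (he : e ∈ G.edgeSet) (v : V) :
    vertexDegree (G.deleteEdges {e}) v + (if v ∈ e then 1 else 0) = vertexDegree G v := by
  split_ifs with hv
  · obtain ⟨w, rfl⟩ := hv
    have hw : w ∉ (G.deleteEdges {s(v, w)}).neighborSet v := by simp
    have hins : G.neighborSet v = insert w ((G.deleteEdges {s(v, w)}).neighborSet v) := by
      ext u
      by_cases huw : u = w
      · simpa [huw] using he
      · simp only [mem_neighborSet, deleteEdges_adj, Set.mem_singleton_iff, Sym2.congr_right, huw,
          not_false_eq_true, and_true, Set.mem_insert_iff, false_or]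
    rw [vertexDegree, vertexDegree, hins, Set.ncard_insert_of_notMem hw]
  · have hnbr : (G.deleteEdges {e}).neighborSet v = G.neighborSet v := by
      ext u
      simp only [SimpleGraph.mem_neighborSet, SimpleGraph.deleteEdges_adj,
        Set.mem_singleton_iff, and_iff_left_iff_imp]
      rintro - rfl
      exact hv (Sym2.mem_mk_left v u)
    rw [vertexDegree, vertexDegree, hnbr, add_zero]

theorem vertexDegree_deleteEdges [Finite V] [DecidableEq V] {G : SimpleGraph V}
    {T : Finset (Sym2 V)} (hT : ↑T ⊆ G.edgeSet) (v : V) :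
    vertexDegree (G.deleteEdges T) v + ∑ e ∈ T, (if v ∈ e then 1 else 0) = vertexDegree G v := by
  induction T using Finset.induction_on with
  | empty => simp
  | insert e T he ih =>
    rw [Finset.coe_insert, Set.insert_subset_iff] at hT
    have hmem : e ∈ (G.deleteEdges T).edgeSet := by
      simpa [edgeSet_deleteEdges, he] using hT.1
    rw [Finset.sum_insert he, ← ih hT.2, ← vertexDegree_deleteEdges_singleton hmem v,
      deleteEdges_deleteEdges, Finset.coe_insert, Set.union_singleton, add_assoc]

end Degrees

section AdjoinVertex

variable {V : Type*}

/-- The graph obtained from `G` by adding a new vertex `none` joined to the vertices in `S`. -/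
def adjoinVertex (G : SimpleGraph V) (S : Finset V) : SimpleGraph (Option V) where
  Adj
    | none, none => False
    | none, some w => w ∈ S
    | some v, none => v ∈ S
    | some v, some w => G.Adj v w
  symm := ⟨by rintro (_ | v) (_ | w) h <;> first | exact h | exact h.symm⟩
  loopless := ⟨by rintro (_ | v) h <;> [exact h; exact G.loopless.irrefl v h]⟩

theorem isContained_adjoinVertex (G : SimpleGraph V) (S : Finset V) : G ⊑ adjoinVertex G S :=
  ⟨⟨⟨some, id⟩, Option.some_injective V⟩⟩

theorem vertexDegree_adjoinVertex_none (G : SimpleGraph V) (S : Finset V) :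
    vertexDegree (adjoinVertex G S) none = S.card := by
  have hnbr : (adjoinVertex G S).neighborSet none = some '' S := by
    ext (_ | w) <;> simp [adjoinVertex]
  rw [vertexDegree, hnbr, Set.ncard_image_of_injective _ (Option.some_injective V),
    Set.ncard_coe_finset]

theorem vertexDegree_adjoinVertex_some [Finite V] [DecidableEq V] (G : SimpleGraph V)
    (S : Finset V) (v : V) :
    vertexDegree (adjoinVertex G S) (some v) = vertexDegree G v + if v ∈ S then 1 else 0 := by
  have hnbr : (adjoinVertex G S).neighborSet (some v) =
      some '' G.neighborSet v ∪ {x | x = none ∧ v ∈ S} := by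
    ext (_ | w) <;> simp [adjoinVertex]
  rw [vertexDegree, vertexDegree, hnbr,
    ← Set.ncard_image_of_injective (G.neighborSet v) (Option.some_injective V)]
  split_ifs with hv
  · simp only [hv, and_true, Set.ofPred_eq_eq_singleton, Set.union_singleton]
    exact Set.ncard_insert_of_notMem (by simp)
  · simp [hv]

theorem univ_val_eq_add_compl [Fintype V] [DecidableEq V] (S : Finset V) :
    (Finset.univ : Finset V).val = S.val + Sᶜ.val := by
  rw [← Finset.disjUnion_val _ _ disjoint_compl_right, Finset.disjUnion_eq_union,
    Finset.union_compl]

theorem degreeMultiset_eq_add [Fintype V] [DecidableEq V] (G : SimpleGraph V) (S : Finset V) :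
    degreeMultiset G = S.val.map (vertexDegree G) + Sᶜ.val.map (vertexDegree G) := by
  rw [degreeMultiset, univ_val_eq_add_compl S, Multiset.map_add]

theorem map_univ_val_option {α : Type*} [Fintype V] (f : Option V → α) :
    (Finset.univ : Finset (Option V)).val.map f =
      f none ::ₘ (Finset.univ : Finset V).val.map fun v => f (some v) := by
  have huniv : (Finset.univ : Finset (Option V)).val = none ::ₘ Finset.univ.val.map some := rfl
  rw [huniv, Multiset.map_cons, Multiset.map_map]
  rfl

/-- The degree sequence that results when a new vertex is joined to vertices with degrees `A`, the
degrees of the remaining vertices being `B`. -/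
def adjoinDegree (A B : Multiset ℕ) : Multiset ℕ :=
  A.card ::ₘ (A.map Nat.succ + B)

theorem degreeMultiset_adjoinVertex [Fintype V] [DecidableEq V] (G : SimpleGraph V)
    (S : Finset V) : degreeMultiset (adjoinVertex G S) =
      adjoinDegree (S.val.map (vertexDegree G)) (Sᶜ.val.map (vertexDegree G)) := by
  rw [degreeMultiset, map_univ_val_option, vertexDegree_adjoinVertex_none, adjoinDegree,
    Multiset.card_map, Finset.card_val, univ_val_eq_add_compl S, Multiset.map_add,
    Multiset.map_map]
  congr 2
  all_goals
    refine Multiset.map_congr rfl fun v hv => ?_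
    simp_all [vertexDegree_adjoinVertex_some]

/-- Every graph arises by adjoining a given vertex `v` to the graph on the other vertices. -/
def adjoinVertexIso [Fintype V] [DecidableEq V] (G : SimpleGraph V) [DecidableRel G.Adj] (v : V) :
    adjoinVertex (G.comap ((↑) : {w // w ≠ v} → V)) {w | G.Adj v w} ≃g G where
  toEquiv := Equiv.optionSubtypeNe v
  map_rel_iff' := by
    rintro (_ | a) (_ | b) <;> simp [adjoinVertex, SimpleGraph.adj_comm]

theorem exists_degreeMultiset_eq_adjoinDegree [Fintype V] [DecidableEq V] (G : SimpleGraph V)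
    (v : V) : ∃ A B, degreeMultiset G = adjoinDegree A B ∧
      degreeMultiset (G.comap ((↑) : {w // w ≠ v} → V)) = A + B ∧ A.card = vertexDegree G v ∧
      (∀ a ∈ A, ∃ s, G.Adj v s ∧ vertexDegree G s = a + 1) ∧
      ∀ b ∈ B, ∃ t, t ≠ v ∧ ¬ G.Adj v t ∧ vertexDegree G t = b := by
  classical
  let G₀ := G.comap ((↑) : {w // w ≠ v} → V)
  let S : Finset {w // w ≠ v} := {w | G.Adj v w}
  let e : adjoinVertex G₀ S ≃g G := adjoinVertexIso G v
  have hdeg (w : {w // w ≠ v}) : vertexDegree G w = vertexDegree G₀ w + if w ∈ S then 1 else 0 := by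
    rw [← vertexDegree_adjoinVertex_some, ← vertexDegree_iso e]
    simp [e, adjoinVertexIso]
  refine ⟨S.val.map (vertexDegree G₀), Sᶜ.val.map (vertexDegree G₀), ?_,
    degreeMultiset_eq_add G₀ S, ?_, ?_, ?_⟩
  · rw [← degreeMultiset_congr e, degreeMultiset_adjoinVertex]
  · rw [Multiset.card_map, Finset.card_val, ← vertexDegree_adjoinVertex_none G₀,
      ← vertexDegree_iso e]
    simp [e, adjoinVertexIso]
  · simp only [Multiset.mem_map, Finset.mem_val]
    rintro _ ⟨w, hw, rfl⟩
    exact ⟨w, by simpa [S] using hw, by rw [hdeg, if_pos hw]⟩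
  · simp only [Multiset.mem_map, Finset.mem_val, Finset.mem_compl]
    rintro _ ⟨w, hw, rfl⟩
    exact ⟨w, w.2, by simpa [S] using hw, by rw [hdeg, if_neg hw, add_zero]⟩

end AdjoinVertex

section Switching

variable {V : Type*}

/-- The exchange of the edges `p q` and `r s` of a graph for `p r` and `q s`. -/
def switchEdges (G : SimpleGraph V) (p q r s : V) : SimpleGraph V :=
  G.deleteEdges {s(p, q), s(r, s)} ⊔ fromEdgeSet {s(p, r), s(q, s)}

theorem vertexDegree_switchEdges [Finite V] {G : SimpleGraph V} {p q r s : V}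
    (hpq : G.Adj p q) (hrs : G.Adj r s) (hpr : ¬ G.Adj p r) (hqs : ¬ G.Adj q s) (hne : p ≠ r)
    (hne' : q ≠ s) : vertexDegree (switchEdges G p q r s) = vertexDegree G := by
  classical
  have hout : (s(p, q) : Sym2 V) ≠ s(r, s) := by
    rintro h
    rcases Sym2.eq_iff.1 h with ⟨rfl, rfl⟩ | ⟨rfl, rfl⟩
    exacts [hne rfl, hpr hrs.symm]
  have hin : (s(p, r) : Sym2 V) ≠ s(q, s) := by
    rintro h
    rcases Sym2.eq_iff.1 h with ⟨rfl, rfl⟩ | ⟨rfl, rfl⟩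
    exacts [hpq.ne rfl, hpr hpq]
  have hcommon : (switchEdges G p q r s).deleteEdges ({s(p, r), s(q, s)} : Finset (Sym2 V)) =
      G.deleteEdges ({s(p, q), s(r, s)} : Finset (Sym2 V)) := by
    rw [← edgeSet_inj]
    ext e
    have hpr' : s(p, r) ∉ G.edgeSet := hpr
    have hqs' : s(q, s) ∉ G.edgeSet := hqs
    simp only [switchEdges, Finset.coe_insert, Finset.coe_singleton, deleteEdges_sup,
      deleteEdges_deleteEdges, Set.union_insert, Set.union_singleton, deleteEdges_fromEdgeSet,
      sdiff_self, Set.bot_eq_empty, fromEdgeSet_empty, bot_le, sup_of_le_left,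
      edgeSet_deleteEdges, Set.mem_sdiff, Set.mem_insert_iff, Set.mem_singleton_iff, not_or,
      and_congr_right_iff]
    grind
  have hnew : (({s(p, r), s(q, s)} : Finset (Sym2 V)) : Set (Sym2 V)) ⊆
      (switchEdges G p q r s).edgeSet := by
    simp [switchEdges, Set.insert_subset_iff, hne, hne']
  have hold : (({s(p, q), s(r, s)} : Finset (Sym2 V)) : Set (Sym2 V)) ⊆ G.edgeSet := by
    simp [Set.insert_subset_iff, hpq, hrs]
  funext v
  rw [← vertexDegree_deleteEdges hnew, ← vertexDegree_deleteEdges hold, hcommon,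
    Finset.sum_pair hout, Finset.sum_pair hin]
  have := hpq.ne
  have := hrs.ne
  simp only [Sym2.mem_iff]
  grind

theorem exists_mem_neighborSet_of_vertexDegree_lt [Finite V] {G : SimpleGraph V} {v s t : V}
    (hvt : G.Adj v t) (hvs : ¬ G.Adj v s) (h : vertexDegree G t < vertexDegree G s) :
    ∃ z, z ≠ t ∧ G.Adj s z ∧ ¬ G.Adj t z := by
  by_contra! hall
  have hsub : G.neighborSet s ⊆ insert t (G.neighborSet t \ {v}) := by
    intro z hz
    by_cases hzt : z = t
    · exact Or.inl hzt
    · exact Or.inr ⟨hall z hzt hz, fun hzv => hvs (hzv ▸ hz.symm)⟩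
  have hle := (Set.ncard_le_ncard hsub (Set.toFinite _)).trans (Set.ncard_insert_le _ _)
  rw [Set.ncard_sdiff_singleton_add_one (s := G.neighborSet t) hvt.symm] at hle
  exact h.not_ge hle

-- Among the graphs with the given degrees, take one whose neighbors of `v` have the largest total
-- degree: a switch at `v` would increase that total.
theorem exists_neighbors_of_largest_degree [Finite V] (G : SimpleGraph V) (v : V) :
    ∃ G' : SimpleGraph V, vertexDegree G' = vertexDegree G ∧
      ∀ s t, G'.Adj v s → t ≠ v → ¬ G'.Adj v t → vertexDegree G' t ≤ vertexDegree G' s := by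
  classical
  have := Fintype.ofFinite V
  let weight (G' : SimpleGraph V) : ℕ := ∑ w with G'.Adj v w, vertexDegree G w
  obtain ⟨G', hG', hmax⟩ := Finset.exists_max_image
    {G' : SimpleGraph V | vertexDegree G' = vertexDegree G} weight ⟨G, by simp⟩
  simp only [Finset.mem_filter, Finset.mem_univ, true_and] at hG' hmax
  refine ⟨G', hG', fun t s hvt hsv hvs => ?_⟩
  by_contra! hlt
  obtain ⟨z, hzt, hsz, htz⟩ := exists_mem_neighborSet_of_vertexDegree_lt hvt hvs hlt
  have hvz : z ≠ v := fun h => hvs (h ▸ hsz.symm)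
  have hdeg := vertexDegree_switchEdges hvt hsz hvs htz hsv.symm hzt.symm
  refine (hmax _ (hdeg.trans hG')).not_gt ?_
  have hnbr : ({w | (switchEdges G' v t s z).Adj v w} : Finset V) =
      insert s (({w | G'.Adj v w} : Finset V).erase t) := by
    ext w
    have := hvt.ne
    simp only [switchEdges, sup_adj, deleteEdges_adj, Set.mem_insert_iff, Sym2.eq, Sym2.rel_iff',
      Prod.mk.injEq, true_and, Prod.swap_prod_mk, Set.mem_singleton_iff, not_or, not_and,
      fromEdgeSet_adj, ne_eq, Finset.mem_filter, Finset.mem_univ, Finset.mem_insert,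
      Finset.mem_erase]
    grind
  have hs : s ∉ ({w | G'.Adj v w} : Finset V).erase t := by simp [hvs]
  have ht : t ∈ ({w | G'.Adj v w} : Finset V) := by simpa using hvt
  change _ < ∑ w with (switchEdges G' v t s z).Adj v w, vertexDegree G w
  rw [hnbr, Finset.sum_insert hs]
  change ∑ w with G'.Adj v w, vertexDegree G w < _
  rw [← Finset.add_sum_erase _ _ ht, ← hG']
  exact Nat.add_lt_add_right hlt _

end Switching

section GraphicMultisets

variable {V : Type*} {H : SimpleGraph V} {M A B : Multiset ℕ}

/-- A multiset that is the degree sequence of some finite graph. -/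
def GraphicMultiset (M : Multiset ℕ) : Prop :=
  ∃ (n : ℕ) (G : SimpleGraph (Fin n)), degreeMultiset G = M

/-- A multiset that is the degree sequence of some finite graph containing `H` as a subgraph:
the version of `PotentiallyGraphic` that does not depend on the order of the degrees. -/
def GraphicContaining (H : SimpleGraph V) (M : Multiset ℕ) : Prop :=
  ∃ (n : ℕ) (G : SimpleGraph (Fin n)), H ⊑ G ∧ degreeMultiset G = M

theorem exists_fin_iso {W : Type*} [Finite W] (G : SimpleGraph W) :
    ∃ (n : ℕ) (G' : SimpleGraph (Fin n)), Nonempty (G ≃g G') :=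
  ⟨_, _, ⟨Iso.map (Finite.equivFin W) G⟩⟩

theorem graphicMultiset_degreeMultiset {W : Type*} [Fintype W] (G : SimpleGraph W) :
    GraphicMultiset (degreeMultiset G) := by
  obtain ⟨n, G', ⟨e⟩⟩ := exists_fin_iso G
  exact ⟨n, G', (degreeMultiset_congr e).symm⟩

theorem graphicContaining_degreeMultiset {W : Type*} [Fintype W] {G : SimpleGraph W}
    (h : H ⊑ G) : GraphicContaining H (degreeMultiset G) := by
  obtain ⟨n, G', ⟨e⟩⟩ := exists_fin_iso G
  exact ⟨n, G', h.trans ⟨e.toCopy⟩, (degreeMultiset_congr e).symm⟩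

theorem exists_le_map_eq {α β : Type*} {f : α → β} {s : Multiset α} {t : Multiset β}
    (h : t ≤ s.map f) : ∃ u ≤ s, u.map f = t := by
  induction s, t using Quotient.inductionOn₂ with
  | _ l₁ l₂ =>
    obtain ⟨l, hperm, hsub⟩ := h
    obtain ⟨l', hl', rfl⟩ := List.sublist_map_iff.1 hsub
    exact ⟨l', hl'.subperm, Quotient.sound hperm⟩

theorem exists_finset_degreeMultiset_eq {W : Type*} [Fintype W] [DecidableEq W]
    {G : SimpleGraph W} (h : degreeMultiset G = A + B) :
    ∃ S : Finset W, S.val.map (vertexDegree G) = A ∧ Sᶜ.val.map (vertexDegree G) = B := by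
  have hle : A ≤ Finset.univ.val.map (vertexDegree G) := h.ge.trans' (Multiset.le_add_right A B)
  obtain ⟨u, hu, rfl⟩ := exists_le_map_eq hle
  let S : Finset W := ⟨u, Multiset.nodup_of_le hu Finset.univ.nodup⟩
  exact ⟨S, rfl, add_left_cancel ((degreeMultiset_eq_add G S).symm.trans h)⟩

theorem GraphicContaining.adjoin (h : GraphicContaining H (A + B)) :
    GraphicContaining H (adjoinDegree A B) := by
  obtain ⟨n, G, hG, hdeg⟩ := h
  obtain ⟨S, rfl, rfl⟩ := exists_finset_degreeMultiset_eq hdeg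
  rw [← degreeMultiset_adjoinVertex]
  exact graphicContaining_degreeMultiset (hG.trans (isContained_adjoinVertex G S))

theorem GraphicContaining.exists_eq_adjoinDegree [Fintype V] (h : GraphicContaining H M)
    (hcard : Fintype.card V < M.card) :
    ∃ A B, M = adjoinDegree A B ∧ GraphicContaining H (A + B) := by
  obtain ⟨n, G, ⟨c⟩, rfl⟩ := h
  rw [card_degreeMultiset] at hcard
  obtain ⟨v, hv⟩ : ∃ v, v ∉ Set.range c := by
    by_contra! hall
    exact hcard.not_ge (Fintype.card_le_of_surjective c hall)
  let c' : Copy H (G.comap ((↑) : {w // w ≠ v} → Fin n)) :=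
    ⟨⟨fun u => ⟨c u, fun h => hv ⟨u, h⟩⟩, fun h => c.toHom.map_adj h⟩,
      fun a b h => c.injective (congrArg Subtype.val h)⟩
  obtain ⟨A, B, hG, hcomap, -⟩ := exists_degreeMultiset_eq_adjoinDegree G v
  exact ⟨A, B, hG, hcomap ▸ graphicContaining_degreeMultiset ⟨c'⟩⟩

theorem GraphicMultiset.exists_eq_adjoinDegree (h : GraphicMultiset M) {δ : ℕ} (hδ : δ ∈ M) :
    ∃ A B, M = adjoinDegree A B ∧ A.card = δ ∧ (∀ a ∈ A, ∀ b ∈ B, b ≤ a + 1) ∧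
      GraphicMultiset (A + B) := by
  obtain ⟨n, G, rfl⟩ := h
  obtain ⟨v, -, rfl⟩ := Multiset.mem_map.1 hδ
  obtain ⟨G', hdeg, htop⟩ := exists_neighbors_of_largest_degree G v
  obtain ⟨A, B, hG', hcomap, hcard, hA, hB⟩ := exists_degreeMultiset_eq_adjoinDegree G' v
  refine ⟨A, B, ?_, hcard.trans (congrFun hdeg v), fun a ha b hb => ?_,
    hcomap ▸ graphicMultiset_degreeMultiset _⟩
  · rw [← hG', degreeMultiset, degreeMultiset, hdeg]
  · obtain ⟨s, hvs, hs⟩ := hA a ha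
    obtain ⟨t, htv, hvt, ht⟩ := hB b hb
    exact ht ▸ hs ▸ htop s t hvs htv hvt

end GraphicMultisets

section Subdivision

variable {V W : Type*} {H : SimpleGraph V} {M : Multiset ℕ}

theorem exists_deleteEdges_isContained [Finite V] [Finite W] {G : SimpleGraph W} (h : H ⊑ G)
    {k : ℕ} (hk : H.edgeSet.ncard + k ≤ G.edgeSet.ncard) :
    ∃ T : Finset (Sym2 W), ↑T ⊆ G.edgeSet ∧ T.card = k ∧ H ⊑ G.deleteEdges T := by
  obtain ⟨c⟩ := h
  have hused : (Sym2.map c '' H.edgeSet).ncard ≤ H.edgeSet.ncard :=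
    Set.ncard_image_le (Set.toFinite _)
  have hfree : k ≤ (G.edgeSet \ Sym2.map c '' H.edgeSet).ncard := by
    have := Set.le_ncard_sdiff (Sym2.map c '' H.edgeSet) G.edgeSet (Set.toFinite _)
    omega
  obtain ⟨T, hT, hcard⟩ := Set.exists_subset_card_eq hfree
  lift T to Finset (Sym2 W) using Set.toFinite T
  refine ⟨T, hT.trans Set.sdiff_subset, by rwa [Set.ncard_coe_finset] at hcard,
    ⟨⟨⟨c, fun {u v} huv => ?_⟩, c.injective⟩⟩⟩
  rw [deleteEdges_adj]
  exact ⟨c.toHom.map_adj huv, fun hmem => (hT hmem).2 ⟨s(u, v), huv, rfl⟩⟩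

theorem GraphicContaining.exists_deleteEdges [Finite V] (h : GraphicContaining H M) {k : ℕ}
    (hk : 2 * (H.edgeSet.ncard + k) ≤ M.sum) :
    ∃ (n : ℕ) (G : SimpleGraph (Fin n)) (T : Finset (Sym2 (Fin n))), degreeMultiset G = M ∧
      ↑T ⊆ G.edgeSet ∧ T.card = k ∧ H ⊑ G.deleteEdges T := by
  obtain ⟨n, G, hG, rfl⟩ := h
  rw [sum_degreeMultiset] at hk
  obtain ⟨T, hT⟩ := exists_deleteEdges_isContained hG (by omega : H.edgeSet.ncard + k ≤ _)
  exact ⟨n, G, T, rfl, hT⟩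

theorem GraphicContaining.subdivide [Finite V] (h : GraphicContaining H M)
    (hsum : 2 * H.edgeSet.ncard < M.sum) : GraphicContaining H (2 ::ₘ M) := by
  have heven : 2 * (H.edgeSet.ncard + 1) ≤ M.sum := by
    obtain ⟨n, G, -, rfl⟩ := h
    rw [sum_degreeMultiset] at hsum ⊢
    omega
  obtain ⟨n, G, T, rfl, hT, hcard, hG⟩ := h.exists_deleteEdges heven
  obtain ⟨e, rfl⟩ := Finset.card_eq_one.1 hcard
  have he : e ∈ G.edgeSet := by simpa using hT
  have hends : e.toFinset.card = 2 :=
    Sym2.card_toFinset_of_not_isDiag e (G.not_isDiag_of_mem_edgeSet he)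
  convert graphicContaining_degreeMultiset (hG.trans (isContained_adjoinVertex _ e.toFinset))
  rw [degreeMultiset, degreeMultiset, map_univ_val_option, vertexDegree_adjoinVertex_none, hends]
  refine congrArg _ (Multiset.map_congr rfl fun v _ => ?_)
  rw [vertexDegree_adjoinVertex_some, ← vertexDegree_deleteEdges hT, Finset.sum_singleton]
  simp only [Sym2.mem_toFinset]

theorem GraphicContaining.subdivide_two [Finite V] (h : GraphicContaining H M)
    (hsum : 2 * H.edgeSet.ncard + 2 < M.sum) : GraphicContaining H (3 ::ₘ 3 ::ₘ M) := by
  have heven : 2 * (H.edgeSet.ncard + 2) ≤ M.sum := by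
    obtain ⟨n, G, -, rfl⟩ := h
    rw [sum_degreeMultiset] at hsum ⊢
    omega
  obtain ⟨n, G, T, rfl, hT, hcard, hG⟩ := h.exists_deleteEdges heven
  obtain ⟨e, f, hef, rfl⟩ := Finset.card_eq_two.1 hcard
  have hends : ∀ e' ∈ ({e, f} : Finset (Sym2 (Fin n))), e'.toFinset.card = 2 := fun e' he' =>
    Sym2.card_toFinset_of_not_isDiag e' (G.not_isDiag_of_mem_edgeSet (hT he'))
  convert graphicContaining_degreeMultiset ((hG.trans (isContained_adjoinVertex _ e.toFinset)).trans
    (isContained_adjoinVertex _ (Finset.insertNone f.toFinset)))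
  rw [degreeMultiset, degreeMultiset, map_univ_val_option, vertexDegree_adjoinVertex_none,
    Finset.card_insertNone, hends f (by simp), map_univ_val_option, vertexDegree_adjoinVertex_some,
    if_pos (by simp), vertexDegree_adjoinVertex_none, hends e (by simp)]
  refine congrArg _ (congrArg _ (Multiset.map_congr rfl fun v _ => ?_))
  rw [vertexDegree_adjoinVertex_some, vertexDegree_adjoinVertex_some,
    ← vertexDegree_deleteEdges hT, Finset.sum_pair hef, ← add_assoc]
  simp only [Finset.some_mem_insertNone, Sym2.mem_toFinset]

end Subdivision

section Operations

variable {V : Type*} {H : SimpleGraph V} {M : Multiset ℕ}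

theorem GraphicContaining.pendantSubdivide [Finite V] (h : GraphicContaining H M)
    (hsum : 2 * H.edgeSet.ncard < M.sum) : GraphicContaining H (1 ::ₘ 3 ::ₘ M) := by
  simpa [adjoinDegree] using GraphicContaining.adjoin (A := {2}) (B := M) (h.subdivide hsum)

theorem GraphicContaining.attachTriangle {x : ℕ} (h : GraphicContaining H (x ::ₘ M)) :
    GraphicContaining H ((x + 2) ::ₘ 2 ::ₘ 2 ::ₘ M) := by
  have hedge : GraphicContaining H (1 ::ₘ (x + 1) ::ₘ M) := by
    simpa [adjoinDegree] using GraphicContaining.adjoin (A := {x}) (B := M) h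
  have htri := GraphicContaining.adjoin (A := {1, x + 1}) (B := M) (by simpa using hedge)
  rw [Multiset.cons_swap (x + 2), Multiset.cons_swap (x + 2)]
  simpa [adjoinDegree] using htri

theorem GraphicContaining.addComplete (h : GraphicContaining H M) (m : ℕ) :
    GraphicContaining H (Multiset.replicate (m + 1) m + M) := by
  induction m with
  | zero => simpa [adjoinDegree] using GraphicContaining.adjoin (A := 0) (B := M) (by simpa using h)
  | succ m ih => simpa [adjoinDegree, Multiset.replicate_succ] using ih.adjoin

theorem GraphicContaining.addTwos [Finite V] (h : GraphicContaining H M)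
    (hsum : 2 * H.edgeSet.ncard < M.sum) (r : ℕ) :
    GraphicContaining H (.replicate r 2 + M) := by
  induction r with
  | zero => simpa using h
  | succ r ih =>
    rw [Multiset.replicate_succ, Multiset.cons_add]
    exact ih.subdivide (by rw [Multiset.sum_add]; omega)

theorem GraphicContaining.addThrees [Finite V] (h : GraphicContaining H M)
    (hsum : 2 * H.edgeSet.ncard + 2 < M.sum) (r : ℕ) :
    GraphicContaining H (.replicate (2 * r) 3 + M) := by
  induction r with
  | zero => simpa using h
  | succ r ih =>
    rw [mul_add_one, Multiset.replicate_succ, Multiset.replicate_succ, Multiset.cons_add,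
      Multiset.cons_add]
    exact ih.subdivide_two (by rw [Multiset.sum_add]; omega)

theorem GraphicContaining.addOnes (h : GraphicContaining H M) (r : ℕ) :
    GraphicContaining H (.replicate (2 * r) 1 + M) := by
  induction r with
  | zero => simpa using h
  | succ r ih =>
    simpa [mul_add_one, Multiset.replicate_succ] using ih.addComplete 1

end Operations

section DegreeBounds

variable {V : Type*} {H : SimpleGraph V} {M : Multiset ℕ}

theorem GraphicContaining.countP_le [Fintype V] (h : GraphicContaining H M) (t : ℕ) :
    (degreeMultiset H).countP (t ≤ ·) ≤ M.countP (t ≤ ·) := by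
  classical
  obtain ⟨n, G, ⟨c⟩, rfl⟩ := h
  have hdeg (v : V) : vertexDegree H v ≤ vertexDegree G (c v) := by
    simpa only [vertexDegree_eq_degree] using c.degree_le v
  simp only [degreeMultiset, Multiset.countP_map]
  change (Finset.univ.filter fun v => t ≤ vertexDegree H v).card ≤
    (Finset.univ.filter fun v => t ≤ vertexDegree G v).card
  exact Finset.card_le_card_of_injOn c
    (fun v hv => by simpa using (Finset.mem_filter.1 hv).2.trans (hdeg v)) c.injective.injOn

theorem GraphicContaining.two_mul_ncard_edgeSet_le_sum (h : GraphicContaining H M) :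
    2 * H.edgeSet.ncard ≤ M.sum := by
  obtain ⟨n, G, ⟨c⟩, rfl⟩ := h
  rw [sum_degreeMultiset]
  exact Nat.mul_le_mul_left 2 (Finite.card_le_of_embedding c.mapEdgeSet)

theorem sum_adjoinDegree (A B : Multiset ℕ) :
    (adjoinDegree A B).sum = (A + B).sum + 2 * A.card := by
  simp only [adjoinDegree, Nat.succ_eq_add_one, Multiset.sum_cons, Multiset.sum_add,
    Multiset.sum_map_add, Multiset.map_id', Multiset.map_const', Multiset.sum_replicate,
    smul_eq_mul, mul_one]
  ring

theorem card_adjoinDegree (A B : Multiset ℕ) :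
    (adjoinDegree A B).card = (A + B).card + 1 := by
  simp [adjoinDegree]

-- Each of the `r` vertices outside the copy of `H` has at most `r - 1` neighbors outside it, hence
-- at least `k + 1` neighbors inside: the total is at least `2 * e(H) + r * (k + 1) + r * (r + k)`.
theorem GraphicContaining.le_sum [Fintype V] {r k : ℕ} (h : GraphicContaining H M)
    (hcard : M.card = Fintype.card V + r) (hmin : ∀ x ∈ M, r + k ≤ x) :
    2 * H.edgeSet.ncard + r * (r + 1 + 2 * k) ≤ M.sum := by
  induction r generalizing M with
  | zero => simpa using h.two_mul_ncard_edgeSet_le_sum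
  | succ r ih =>
    obtain ⟨A, B, rfl, h'⟩ := h.exists_eq_adjoinDegree (by omega)
    rw [card_adjoinDegree] at hcard
    simp only [adjoinDegree, Multiset.mem_cons, Multiset.mem_add, Multiset.mem_map,
      forall_eq_or_imp] at hmin
    have hrec := ih h' (by omega) fun x hx => by
      rcases Multiset.mem_add.1 hx with hx | hx
      · have := hmin.2 _ (Or.inl ⟨x, hx, rfl⟩)
        omega
      · have := hmin.2 _ (Or.inr hx)
        omega
    have := hmin.1
    rw [sum_adjoinDegree]
    nlinarith

end DegreeBounds

section BaseGraphs

theorem K5MinusP3_eq_deleteEdges :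
    K5MinusP3 = (⊤ : SimpleGraph (Fin 5)).deleteEdges
      ({s(0, 1), s(1, 2), s(2, 3)} : Finset (Sym2 (Fin 5))) := by
  ext i j
  rw [K5MinusP3, deleteEdges_adj, deleteEdges_adj, mem_edgeSet, map_adj]
  simp only [pathWithEdges, pathGraph_adj, Fin.coe_castSuccEmb, Finset.mem_coe, top_adj]
  revert i j
  decide

theorem degreeMultiset_top_deleteEdges {n : ℕ} (T : Finset (Sym2 (Fin n)))
    (hT : ∀ e ∈ T, ¬ e.IsDiag) :
    degreeMultiset ((⊤ : SimpleGraph (Fin n)).deleteEdges T) =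
      Finset.univ.val.map fun v => n - 1 - ∑ e ∈ T, if v ∈ e then 1 else 0 := by
  refine Multiset.map_congr rfl fun v _ => ?_
  have htop : vertexDegree (⊤ : SimpleGraph (Fin n)) v = n - 1 := by
    simp [vertexDegree_eq_degree]
  have hsub : (T : Set (Sym2 (Fin n))) ⊆ (⊤ : SimpleGraph (Fin n)).edgeSet := fun e he => by
    simpa using hT e he
  rw [← htop, ← vertexDegree_deleteEdges hsub v, Nat.add_sub_cancel]

theorem degreeMultiset_K5MinusP3 : degreeMultiset K5MinusP3 = {4, 3, 3, 2, 2} := by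
  rw [K5MinusP3_eq_deleteEdges, degreeMultiset_top_deleteEdges _ (by decide)]
  decide

theorem two_mul_ncard_edgeSet_K5MinusP3 : 2 * K5MinusP3.edgeSet.ncard = 14 := by
  rw [← sum_degreeMultiset, degreeMultiset_K5MinusP3]
  rfl

theorem graphicContaining_of_subset_path (T : Finset (Sym2 (Fin 5))) {M : Multiset ℕ}
    (hT : T ⊆ {s(0, 1), s(1, 2), s(2, 3)})
    (hM : (Finset.univ.val.map fun v : Fin 5 => 4 - ∑ e ∈ T, if v ∈ e then 1 else 0) = M) :
    GraphicContaining K5MinusP3 M := by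
  have hdiag : ∀ e ∈ ({s(0, 1), s(1, 2), s(2, 3)} : Finset (Sym2 (Fin 5))), ¬ e.IsDiag := by decide
  rw [← hM, ← degreeMultiset_top_deleteEdges T fun e he => hdiag e (hT he)]
  refine graphicContaining_degreeMultiset (.of_le ?_)
  rw [K5MinusP3_eq_deleteEdges]
  exact deleteEdges_anti (Finset.coe_subset.2 hT)

end BaseGraphs

section SmallDegrees

/-- The degree sequence with `k` fours, `a` threes, `b` twos and `c` ones. -/
def smallDegrees (k a b c : ℕ) : Multiset ℕ :=
  .replicate k 4 + .replicate a 3 + .replicate b 2 + .replicate c 1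

theorem sum_smallDegrees (k a b c : ℕ) :
    (smallDegrees k a b c).sum = 4 * k + 3 * a + 2 * b + c := by
  simp only [smallDegrees, Multiset.sum_add, Multiset.sum_replicate, smul_eq_mul]
  ring

theorem eq_smallDegrees {M : Multiset ℕ} (hpos : ∀ x ∈ M, 1 ≤ x) (hle : ∀ x ∈ M, x ≤ 4) :
    M = smallDegrees (M.count 4) (M.count 3) (M.count 2) (M.count 1) := by
  ext x
  by_cases hx : x ∈ M
  · have h1 := hpos x hx
    have h4 := hle x hx
    interval_cases x <;> simp [smallDegrees, Multiset.count_replicate]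
  · simp only [smallDegrees, Multiset.count_add, Multiset.count_replicate]
    split_ifs <;> simp_all

variable {k a b c : ℕ}

theorem smallDegrees_addTwos (h : GraphicContaining K5MinusP3 (smallDegrees k a b c))
    (hsum : 14 < 4 * k + 3 * a + 2 * b + c) (r : ℕ) :
    GraphicContaining K5MinusP3 (smallDegrees k a (b + r) c) := by
  convert h.addTwos (by rwa [two_mul_ncard_edgeSet_K5MinusP3, sum_smallDegrees]) r using 1
  rw [smallDegrees, smallDegrees, Multiset.replicate_add]
  abel

theorem smallDegrees_addThrees (h : GraphicContaining K5MinusP3 (smallDegrees k a b c))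
    (hsum : 16 < 4 * k + 3 * a + 2 * b + c) (r : ℕ) :
    GraphicContaining K5MinusP3 (smallDegrees k (a + 2 * r) b c) := by
  convert h.addThrees (by rwa [two_mul_ncard_edgeSet_K5MinusP3, sum_smallDegrees]) r using 1
  rw [smallDegrees, smallDegrees, Multiset.replicate_add]
  abel

theorem smallDegrees_addOnes (h : GraphicContaining K5MinusP3 (smallDegrees k a b c)) (r : ℕ) :
    GraphicContaining K5MinusP3 (smallDegrees k a b (c + 2 * r)) := by
  convert h.addOnes r using 1
  rw [smallDegrees, smallDegrees, Multiset.replicate_add]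
  abel

theorem smallDegrees_pendantSubdivide (h : GraphicContaining K5MinusP3 (smallDegrees k a b c))
    (hsum : 14 < 4 * k + 3 * a + 2 * b + c) :
    GraphicContaining K5MinusP3 (smallDegrees k (a + 1) b (c + 1)) := by
  convert h.pendantSubdivide (by rwa [two_mul_ncard_edgeSet_K5MinusP3, sum_smallDegrees]) using 1
  simp [smallDegrees, Multiset.replicate_succ]

theorem graphicContaining_gem : GraphicContaining K5MinusP3 (smallDegrees 1 2 2 0) :=
  graphicContaining_of_subset_path {s(0, 1), s(1, 2), s(2, 3)} (by decide) (by decide)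

theorem graphicContaining_wheel : GraphicContaining K5MinusP3 (smallDegrees 1 4 0 0) :=
  graphicContaining_of_subset_path {s(0, 1), s(2, 3)} (by decide) (by decide)

theorem smallDegrees_one_four_two (b c : ℕ) (hc : Even c) (hbc : b ≠ 3 ∨ c ≠ 0)
    (hbc' : b ≠ 4 ∨ c ≠ 0) (hb : 2 ≤ b) :
    GraphicContaining K5MinusP3 (smallDegrees 1 2 b c) := by
  obtain ⟨r, rfl⟩ := hc.two_dvd
  rcases r.eq_zero_or_pos with rfl | hr
  · obtain rfl | hb : b = 2 ∨ 5 ≤ b := by omega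
    · exact graphicContaining_gem
    have gem_triangle : GraphicContaining K5MinusP3 (smallDegrees 1 2 5 0) := by
      convert graphicContaining_gem.addComplete 2 using 1
      decide
    obtain ⟨s, rfl⟩ := Nat.exists_eq_add_of_le hb
    exact smallDegrees_addTwos gem_triangle (by omega) s
  · obtain ⟨s, rfl⟩ := Nat.exists_eq_add_of_le hb
    have gem_ones : GraphicContaining K5MinusP3 (smallDegrees 1 2 2 (2 * r)) := by
      simpa using smallDegrees_addOnes graphicContaining_gem r
    exact smallDegrees_addTwos gem_ones (by omega) s

theorem smallDegrees_one_four_three (b c : ℕ) (hc : Odd c) (hb : 1 ≤ b) :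
    GraphicContaining K5MinusP3 (smallDegrees 1 3 b c) := by
  have gem_pendant : GraphicContaining K5MinusP3 (smallDegrees 1 3 1 1) := by
    convert GraphicContaining.adjoin (A := {2}) (B := {4, 3, 3, 2}) (H := K5MinusP3) ?_ using 1
    · decide
    · convert graphicContaining_gem using 1
      decide
  obtain ⟨r, rfl⟩ := hc
  obtain ⟨s, rfl⟩ := Nat.exists_eq_add_of_le hb
  rw [Nat.add_comm (2 * r) 1]
  exact smallDegrees_addOnes (smallDegrees_addTwos gem_pendant (by omega) s) r

theorem smallDegrees_one_four_four (b c : ℕ) (hc : Even c) :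
    GraphicContaining K5MinusP3 (smallDegrees 1 4 b c) := by
  obtain ⟨r, rfl⟩ := hc.two_dvd
  simpa using smallDegrees_addOnes (smallDegrees_addTwos graphicContaining_wheel (by omega) b) r

theorem smallDegrees_one_four {a b c : ℕ} (ha : 2 ≤ a) (hab : 4 ≤ a + b) (hac : Even (a + c))
    (h23 : ¬ (a = 2 ∧ b = 3 ∧ c = 0)) (h24 : ¬ (a = 2 ∧ b = 4 ∧ c = 0))
    (h60 : ¬ (a = 6 ∧ b = 0 ∧ c = 0)) :
    GraphicContaining K5MinusP3 (smallDegrees 1 a b c) := by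
  have wheel_K4 : GraphicContaining K5MinusP3 (smallDegrees 1 8 0 0) := by
    convert graphicContaining_wheel.addComplete 3 using 1
    decide
  induction a using Nat.strong_induction_on generalizing c with
  | _ a ih =>
    rw [Nat.even_iff] at hac
    obtain rfl | rfl | rfl | ha5 : a = 2 ∨ a = 3 ∨ a = 4 ∨ 5 ≤ a := by omega
    · exact smallDegrees_one_four_two b c (by grind) (by omega) (by omega) (by omega)
    · exact smallDegrees_one_four_three b c (by grind) (by omega)
    · exact smallDegrees_one_four_four b c (by grind)
    by_cases h80 : a = 8 ∧ b = 0 ∧ c = 0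
    · obtain ⟨rfl, rfl, rfl⟩ := h80
      exact wheel_K4
    by_cases hc : a ≤ 6 ∧ c ≠ 0
    · obtain ⟨a, rfl⟩ := Nat.exists_eq_succ_of_ne_zero (by omega : a ≠ 0)
      obtain ⟨c, rfl⟩ := Nat.exists_eq_succ_of_ne_zero hc.2
      exact smallDegrees_pendantSubdivide (ih a (by omega) (by omega) (by omega)
        (by grind) (by omega) (by omega) (by omega)) (by omega)
    · obtain ⟨a, rfl⟩ := Nat.exists_eq_add_of_le' ha
      exact smallDegrees_addThrees (ih a (by omega) (by omega) (by omega)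
        (by grind) (by omega) (by omega) (by omega)) (by omega) 1

theorem smallDegrees_two_fours {a b : ℕ} (ha : 2 ≤ a) (hab : 3 ≤ a + b) (heven : Even a) :
    GraphicContaining K5MinusP3 (smallDegrees 2 a b 0) := by
  have K5_sub_path : GraphicContaining K5MinusP3 (smallDegrees 2 2 1 0) :=
    graphicContaining_of_subset_path {s(0, 1), s(1, 2)} (by decide) (by decide)
  have gem_adjoin : GraphicContaining K5MinusP3 (smallDegrees 2 4 0 0) := by
    convert GraphicContaining.adjoin (A := {3, 2, 2}) (B := {4, 3}) (H := K5MinusP3) ?_ using 1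
    · decide
    · convert graphicContaining_gem using 1
      decide
  obtain ⟨r, rfl⟩ := heven.two_dvd
  obtain rfl | hr : r = 1 ∨ 2 ≤ r := by omega
  · obtain ⟨s, rfl⟩ := Nat.exists_eq_add_of_le (by omega : 1 ≤ b)
    exact smallDegrees_addTwos K5_sub_path (by omega) s
  · obtain ⟨s, rfl⟩ := Nat.exists_eq_add_of_le hr
    simpa [mul_add] using smallDegrees_addThrees
      (smallDegrees_addTwos gem_adjoin (by omega) b) (by omega) s

theorem smallDegrees_three_fours {a : ℕ} (ha : 2 ≤ a) (heven : Even a) :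
    GraphicContaining K5MinusP3 (smallDegrees 3 a 0 0) := by
  have K5_sub_edge : GraphicContaining K5MinusP3 (smallDegrees 3 2 0 0) :=
    graphicContaining_of_subset_path {s(0, 1)} (by decide) (by decide)
  obtain ⟨r, rfl⟩ := heven.two_dvd
  obtain ⟨s, rfl⟩ := Nat.exists_eq_add_of_le (by omega : 1 ≤ r)
  simpa [mul_add] using smallDegrees_addThrees K5_sub_edge (by omega) s

theorem graphicContaining_triangles (m : ℕ) :
    GraphicContaining K5MinusP3 ((2 * m + 4) ::ₘ smallDegrees 0 2 (2 * m + 2) 0) := by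
  induction m with
  | zero =>
    convert graphicContaining_gem using 1
    decide
  | succ m ih =>
    convert ih.attachTriangle using 2
    · ring
    · simp [smallDegrees, mul_add_one, Multiset.replicate_succ]

theorem graphicContaining_one_large {m b : ℕ} (hm : 1 ≤ m) (hb : 2 * m + 2 ≤ b) :
    GraphicContaining K5MinusP3 ((2 * m + 4) ::ₘ smallDegrees 0 2 b 0) := by
  obtain ⟨s, rfl⟩ := Nat.exists_eq_add_of_le hb
  convert (graphicContaining_triangles m).addTwos (r := s) _ using 1
  · rw [smallDegrees, smallDegrees, Multiset.replicate_add, Multiset.add_cons]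
    congr 1
    abel
  · rw [two_mul_ncard_edgeSet_K5MinusP3, Multiset.sum_cons, sum_smallDegrees]
    omega

end SmallDegrees

section Necessity

/-- `M` dominates `(4, 3, 3, 2, 2)`, the degree sequence of `K_5 - P_3` (the gem), in the sense
that its five largest entries are entrywise at least `4, 3, 3, 2, 2`. -/
def DominatesGem (M : Multiset ℕ) : Prop :=
  1 ≤ M.countP (4 ≤ ·) ∧ 3 ≤ M.countP (3 ≤ ·) ∧ 5 ≤ M.countP (2 ≤ ·)

/-- The three degree sequences that dominate that of `K_5 - P_3` but have no realization
containing it. -/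
def IsExceptional (M : Multiset ℕ) : Prop :=
  M = smallDegrees 1 2 3 0 ∨ M = smallDegrees 1 2 4 0 ∨ M = smallDegrees 1 6 0 0

variable {M : Multiset ℕ}

theorem GraphicContaining.dominatesGem (h : GraphicContaining K5MinusP3 M) : DominatesGem M := by
  have hle := h.countP_le
  rw [degreeMultiset_K5MinusP3] at hle
  exact ⟨hle 4, hle 3, hle 2⟩

theorem GraphicContaining.not_isExceptional (h : GraphicContaining K5MinusP3 M) :
    ¬ IsExceptional M := by
  rintro (rfl | rfl | rfl)
  · have hle := h.le_sum (r := 1) (k := 1) (by decide) (by decide)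
    simp [two_mul_ncard_edgeSet_K5MinusP3, sum_smallDegrees] at hle
  · have hle := h.le_sum (r := 2) (k := 0) (by decide) (by decide)
    simp [two_mul_ncard_edgeSet_K5MinusP3, sum_smallDegrees] at hle
  · have hle := h.le_sum (r := 2) (k := 1) (by decide) (by decide)
    simp [two_mul_ncard_edgeSet_K5MinusP3, sum_smallDegrees] at hle

end Necessity

section Sufficiency

variable {M A B : Multiset ℕ}

theorem GraphicMultiset.even_sum (h : GraphicMultiset M) : Even M.sum := by
  obtain ⟨n, G, rfl⟩ := h
  exact sum_degreeMultiset G ▸ even_two_mul _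

theorem GraphicMultiset.lt_card (h : GraphicMultiset M) {x : ℕ} (hx : x ∈ M) : x < M.card := by
  classical
  obtain ⟨n, G, rfl⟩ := h
  obtain ⟨v, -, rfl⟩ := Multiset.mem_map.1 hx
  rw [vertexDegree_eq_degree, card_degreeMultiset]
  exact G.degree_lt_card_verts v

theorem adjoinDegree_add_right (A B C : Multiset ℕ) :
    adjoinDegree A (B + C) = B + adjoinDegree A C := by
  rw [adjoinDegree, adjoinDegree, Multiset.add_cons, add_left_comm]

/-- Adjoining a vertex to a graph with degrees `A + B` so that exactly the vertices with degrees
in `A` become neighbors undoes a Havel–Hakimi step in which a vertex of minimum degree, not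
isolated, is laid off and its neighbors have the largest degrees possible. -/
structure IsMinLayoff (A B : Multiset ℕ) : Prop where
  ne_zero : A ≠ 0
  card_le : ∀ x ∈ adjoinDegree A B, A.card ≤ x
  le_add_one : ∀ a ∈ A, ∀ b ∈ B, b ≤ a + 1

theorem IsMinLayoff.card_le_left (h : IsMinLayoff A B) (a : ℕ) (ha : a ∈ A) : A.card ≤ a + 1 :=
  h.card_le _ (by simp [adjoinDegree, ha])

theorem IsMinLayoff.card_le_right (h : IsMinLayoff A B) (b : ℕ) (hb : b ∈ B) : A.card ≤ b :=
  h.card_le _ (by simp [adjoinDegree, hb])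

theorem GraphicMultiset.exists_isMinLayoff (h : GraphicMultiset M) (hM : M ≠ 0)
    (hpos : ∀ x ∈ M, 1 ≤ x) :
    ∃ A B, M = adjoinDegree A B ∧ IsMinLayoff A B ∧ GraphicMultiset (A + B) := by
  obtain ⟨δ, hδ, hmin⟩ := M.toFinset.exists_min_image id (by simpa using hM)
  simp only [Multiset.mem_toFinset, id] at hδ hmin
  obtain ⟨A, B, rfl, rfl, htop, hAB⟩ := h.exists_eq_adjoinDegree hδ
  exact ⟨A, B, rfl, ⟨Multiset.card_pos.1 (hpos _ hδ), hmin, htop⟩, hAB⟩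

theorem IsMinLayoff.count_two_le (h : IsMinLayoff A B) (h4 : 4 ∈ A + B) : A.count 2 ≤ 2 := by
  by_contra! hcount
  have h2 : 2 ∈ A := Multiset.count_pos.1 (by omega)
  have hall : ∀ a ∈ A, 2 = a := Multiset.count_eq_card.1 <|
    (Multiset.count_le_card 2 A).antisymm ((h.card_le_left 2 h2).trans hcount)
  rcases Multiset.mem_add.1 h4 with h4 | h4
  · exact absurd (hall 4 h4) (by decide)
  · exact absurd (h.le_add_one 2 h2 4 h4) (by decide)

theorem IsMinLayoff.count_three_le (h : IsMinLayoff A B) : A.count 3 ≤ 4 := by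
  by_contra! hcount
  have hcard := h.card_le_left 3 (Multiset.count_pos.1 (by omega))
  have := Multiset.count_le_card 3 A
  omega

theorem exists_eq_replicate_add {r f : ℕ} {C : Multiset ℕ} (h : A + B = .replicate r f + C)
    (hcount : A.count f ≤ C.count f) :
    ∃ B', B = .replicate r f + B' ∧ A + B' = C := by
  have hB : r ≤ B.count f := by
    have := congrArg (Multiset.count f) h
    simp only [Multiset.count_add, Multiset.count_replicate_self] at this
    omega
  obtain ⟨B', rfl⟩ := Multiset.le_iff_exists_add.1 (Multiset.le_count_iff_replicate_le.1 hB)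
  exact ⟨B', rfl, add_left_cancel ((add_left_comm _ _ _).symm.trans h)⟩

-- The exceptional sequences consist of a graphic core containing the gem and of surplus twos or
-- threes; the surplus lies outside `A`, so it can be reinserted by subdivision after adjoining.
theorem IsMinLayoff.graphicContaining_of_isExceptional (h : IsMinLayoff A B)
    (hE : IsExceptional (A + B)) :
    GraphicContaining K5MinusP3 (adjoinDegree A B) := by
  have hcard : 0 < A.card := Multiset.card_pos.2 h.ne_zero
  have twos {r : ℕ} (hr : A + B = smallDegrees 1 2 (2 + r) 0) :
      GraphicContaining K5MinusP3 (adjoinDegree A B) := by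
    have hcore : A + B = .replicate r 2 + smallDegrees 1 2 2 0 := by
      rw [hr, smallDegrees, smallDegrees, Multiset.replicate_add 2 r]
      abel
    obtain ⟨B', rfl, hB'⟩ := exists_eq_replicate_add hcore <|
      h.count_two_le (by simp [hr, smallDegrees])
    rw [adjoinDegree_add_right]
    refine (GraphicContaining.adjoin (hB' ▸ graphicContaining_gem)).addTwos ?_ r
    rw [two_mul_ncard_edgeSet_K5MinusP3, sum_adjoinDegree, hB', sum_smallDegrees]
    omega
  obtain hE | hE | hE := hE
  · exact twos (r := 1) hE
  · exact twos (r := 2) hE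
  · have hcore : A + B = .replicate (2 * 1) 3 + smallDegrees 1 4 0 0 := hE.trans (by decide)
    obtain ⟨B', rfl, hB'⟩ := exists_eq_replicate_add hcore h.count_three_le
    rw [adjoinDegree_add_right]
    refine (GraphicContaining.adjoin (hB' ▸ graphicContaining_wheel)).addThrees ?_ 1
    rw [two_mul_ncard_edgeSet_K5MinusP3, sum_adjoinDegree, hB', sum_smallDegrees]
    omega

theorem countP_adjoinDegree (A B : Multiset ℕ) (t : ℕ) :
    (adjoinDegree A B).countP (t + 1 ≤ ·) =
      (if t + 1 ≤ A.card then 1 else 0) + A.countP (t ≤ ·) + B.countP (t + 1 ≤ ·) := by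
  rw [adjoinDegree, Multiset.countP_cons, Multiset.countP_add, Multiset.countP_map,
    ← Multiset.countP_eq_card_filter]
  simp only [Nat.succ_le_succ_iff, Nat.succ_eq_add_one]
  omega

theorem antitone_countP_le (M : Multiset ℕ) : Antitone fun t => M.countP (t ≤ ·) := by
  intro s t hst
  simp only [Multiset.countP_eq_card_filter]
  exact Multiset.card_le_card (Multiset.monotone_filter_right M fun x h => hst.trans h)

theorem IsMinLayoff.countP_left (h : IsMinLayoff A B) {t : ℕ} (ht : t + 1 ≤ A.card) :
    A.countP (t ≤ ·) = A.card :=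
  Multiset.countP_eq_card.2 fun a ha => by have := h.card_le_left a ha; omega

theorem IsMinLayoff.countP_right (h : IsMinLayoff A B) {t : ℕ} (ht : t ≤ A.card) :
    B.countP (t ≤ ·) = B.card :=
  Multiset.countP_eq_card.2 fun b hb => ht.trans (h.card_le_right b hb)

theorem IsMinLayoff.countP_left_of_right (h : IsMinLayoff A B) {t : ℕ}
    (ht : 0 < B.countP (t + 1 ≤ ·)) : A.countP (t ≤ ·) = A.card := by
  obtain ⟨b, hb, hbt⟩ := Multiset.countP_pos.1 ht
  refine Multiset.countP_eq_card.2 fun a ha => ?_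
  have := h.le_add_one a ha b hb
  omega

theorem countP_eq_zero_iff_le (M : Multiset ℕ) (t : ℕ) :
    M.countP (t + 1 ≤ ·) = 0 ↔ ∀ x ∈ M, x ≤ t := by
  simp only [Multiset.countP_eq_zero, not_le, Nat.lt_add_one_iff]

theorem IsMinLayoff.small_of_countP_four_eq_zero (h : IsMinLayoff A B)
    (h4 : (A + B).countP (4 ≤ ·) = 0) :
    (∀ x ∈ adjoinDegree A B, x ≤ 4) ∧
      (adjoinDegree A B = .replicate 5 4 ∨ (adjoinDegree A B).countP (4 ≤ ·) ≤ min 3 A.card) := by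
  obtain ⟨hA4, hB4⟩ : A.countP (4 ≤ ·) = 0 ∧ B.countP (4 ≤ ·) = 0 := by
    rwa [Multiset.countP_add, Nat.add_eq_zero_iff] at h4
  have hcard : A.card ≤ 4 := by
    by_contra! hcard
    have := h.countP_left (t := 4) hcard
    omega
  have hle : ∀ x ∈ adjoinDegree A B, x ≤ 4 := by
    have hB5 : B.countP (5 ≤ ·) ≤ B.countP (4 ≤ ·) := antitone_countP_le B (by decide)
    rw [← countP_eq_zero_iff_le, countP_adjoinDegree, if_neg (by omega), hA4]
    simp only [Nat.reduceAdd]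
    omega
  refine ⟨hle, ?_⟩
  obtain hcard | hcard := hcard.eq_or_lt
  · left
    have hB : B.card = 0 := by rw [← h.countP_right (t := 4) hcard.ge, hB4]
    refine Multiset.eq_replicate.2 ⟨?_, fun x hx => (hle x hx).antisymm (hcard ▸ h.card_le x hx)⟩
    rw [card_adjoinDegree, Multiset.card_add, hB, hcard]
  · right
    have := A.countP_le_card (3 ≤ ·)
    rw [countP_adjoinDegree, if_neg (by omega)]
    simp only [Nat.reduceAdd]
    omega

theorem IsMinLayoff.one_large_of_countP_three_le (h : IsMinLayoff A B)
    (hM : 3 ≤ (adjoinDegree A B).countP (3 ≤ ·)) (hlt : ∀ x ∈ A + B, x < (A + B).card)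
    (h4 : 0 < (A + B).countP (4 ≤ ·)) (h3 : (A + B).countP (3 ≤ ·) ≤ 2) :
    A.card = 2 ∧ (adjoinDegree A B).countP (5 ≤ ·) = 1 ∧
      (adjoinDegree A B).countP (4 ≤ ·) = 1 ∧ (adjoinDegree A B).countP (3 ≤ ·) = 3 := by
  have hcard : 5 ≤ (A + B).card := by
    obtain ⟨x, hx, hx4⟩ := Multiset.countP_pos.1 h4
    exact hx4.trans_lt (hlt x hx)
  have hB5 : B.countP (5 ≤ ·) ≤ B.countP (4 ≤ ·) := antitone_countP_le B (by decide)
  have hB4 : B.countP (4 ≤ ·) ≤ B.countP (3 ≤ ·) := antitone_countP_le B (by decide)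
  have hA4 : A.countP (4 ≤ ·) ≤ A.countP (3 ≤ ·) := antitone_countP_le A (by decide)
  have hA2 := A.countP_le_card (2 ≤ ·)
  have hA3 := A.countP_le_card (3 ≤ ·)
  have hleft := h.countP_left (t := 3)
  have hright := h.countP_right (t := 3)
  have htop : 0 < B.countP (4 ≤ ·) → A.countP (3 ≤ ·) = A.card := h.countP_left_of_right
  rw [Multiset.countP_add] at h3 h4
  rw [Multiset.card_add] at hcard
  have htwo : A.card = 2 := by
    simp only [countP_adjoinDegree, Nat.reduceAdd] at hM
    split_ifs at hM <;> omega
  refine ⟨htwo, ?_⟩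
  simp only [countP_adjoinDegree, htwo, Nat.reduceAdd, Nat.reduceLeDiff, if_false] at hM ⊢
  omega

theorem IsMinLayoff.five_le_countP_two (h : IsMinLayoff A B)
    (hM : 5 ≤ (adjoinDegree A B).countP (2 ≤ ·)) (hlt : ∀ x ∈ A + B, x < (A + B).card)
    (h4 : 0 < (A + B).countP (4 ≤ ·)) (h3 : 3 ≤ (A + B).countP (3 ≤ ·)) :
    5 ≤ (A + B).countP (2 ≤ ·) := by
  have hcard : 5 ≤ (A + B).card := by
    obtain ⟨x, hx, hx4⟩ := Multiset.countP_pos.1 h4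
    exact hx4.trans_lt (hlt x hx)
  have hA3 : A.countP (3 ≤ ·) ≤ A.countP (2 ≤ ·) := antitone_countP_le A (by decide)
  have hA2 := A.countP_le_card (2 ≤ ·)
  have hA1 := A.countP_le_card (1 ≤ ·)
  have hleft := h.countP_left (t := 2)
  have hright := h.countP_right (t := 2)
  have htop : 0 < B.countP (3 ≤ ·) → A.countP (2 ≤ ·) = A.card := h.countP_left_of_right
  rw [Multiset.countP_add] at h3 h4 ⊢
  rw [Multiset.card_add] at hcard
  simp only [countP_adjoinDegree, Nat.reduceAdd] at hM
  split_ifs at hM <;> omega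

theorem countP_smallDegrees (k a b c : ℕ) :
    (smallDegrees k a b c).countP (4 ≤ ·) = k ∧
      (smallDegrees k a b c).countP (3 ≤ ·) = k + a ∧
      (smallDegrees k a b c).countP (2 ≤ ·) = k + a + b := by
  simp [smallDegrees, ← Multiset.coe_replicate, List.countP_replicate, add_assoc]

theorem exists_eq_cons_smallDegrees (h5 : M.countP (5 ≤ ·) = 1) (h4 : M.countP (4 ≤ ·) = 1)
    (h3 : M.countP (3 ≤ ·) = 3) (h2 : ∀ x ∈ M, 2 ≤ x) :
    ∃ D b, 5 ≤ D ∧ M = D ::ₘ smallDegrees 0 2 b 0 := by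
  obtain ⟨D, hD, hD5⟩ := Multiset.countP_pos.1 (h5 ▸ Nat.one_pos)
  obtain ⟨M', rfl⟩ := Multiset.exists_cons_of_mem hD
  simp only [Multiset.forall_mem_cons, Multiset.countP_cons, if_pos hD5,
    if_pos (hD5.trans' (by decide : 4 ≤ 5)), if_pos (hD5.trans' (by decide : 3 ≤ 5)),
    Nat.add_eq_right] at h5 h4 h3 h2
  have hM' := eq_smallDegrees (fun x hx => (h2.2 x hx).trans' one_le_two)
    ((countP_eq_zero_iff_le M' 4).1 h5)
  have h1 : M'.count 1 = 0 := Multiset.count_eq_zero.2 fun h => absurd (h2.2 1 h) (by decide)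
  obtain ⟨hc4, hc3, -⟩ := countP_smallDegrees (M'.count 4) (M'.count 3) (M'.count 2) (M'.count 1)
  rw [← hM'] at hc4 hc3
  refine ⟨D, M'.count 2, hD5, ?_⟩
  rw [h1, (by omega : M'.count 4 = 0), (by omega : M'.count 3 = 2)] at hM'
  rw [← hM']

theorem graphicContaining_of_one_large {D b : ℕ} (hD : 5 ≤ D)
    (h : GraphicMultiset (D ::ₘ smallDegrees 0 2 b 0)) :
    GraphicContaining K5MinusP3 (D ::ₘ smallDegrees 0 2 b 0) := by
  have heven := h.even_sum
  have hlt := h.lt_card (Multiset.mem_cons_self _ _)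
  rw [Multiset.sum_cons, sum_smallDegrees] at heven
  simp only [Multiset.card_cons, smallDegrees, Multiset.card_add, Multiset.card_replicate] at hlt
  obtain ⟨m, rfl⟩ : ∃ m, D = 2 * m + 4 := ⟨(D - 4) / 2, by grind⟩
  exact graphicContaining_one_large (by omega) (by omega)

theorem graphicContaining_of_small (h : GraphicMultiset M) (hle : ∀ x ∈ M, x ≤ 4)
    (hmin : ∀ x ∈ M, 1 ≤ x ∧ M.countP (4 ≤ ·) ≤ x) (h4 : M.countP (4 ≤ ·) ≤ 3)
    (hdom : DominatesGem M) (hexc : ¬ IsExceptional M) : GraphicContaining K5MinusP3 M := by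
  have hM := eq_smallDegrees (fun x hx => (hmin x hx).1) hle
  generalize M.count 4 = k, M.count 3 = a, M.count 2 = b, M.count 1 = c at hM
  subst hM
  have heven := h.even_sum
  simp only [countP_smallDegrees, DominatesGem, sum_smallDegrees] at *
  have hb : b = 0 ∨ k ≤ 2 :=
    b.eq_zero_or_pos.imp_right fun hb =>
      (hmin 2 (by simp [smallDegrees, Multiset.mem_replicate, hb.ne'])).2
  have hc : c = 0 ∨ k ≤ 1 :=
    c.eq_zero_or_pos.imp_right fun hc =>
      (hmin 1 (by simp [smallDegrees, Multiset.mem_replicate, hc.ne'])).2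
  obtain rfl | rfl | rfl : k = 1 ∨ k = 2 ∨ k = 3 := by omega
  · refine smallDegrees_one_four (by omega) (by omega) (by grind) ?_ ?_ ?_ <;>
      rintro ⟨rfl, rfl, rfl⟩ <;> simp [IsExceptional] at hexc
  · obtain rfl : c = 0 := by omega
    have ha : Even a := by grind
    exact smallDegrees_two_fours (by grind) (by omega) ha
  · obtain rfl : c = 0 := by omega
    obtain rfl : b = 0 := by omega
    exact smallDegrees_three_fours (by omega) (by grind)

theorem graphicContaining_replicate_four : GraphicContaining K5MinusP3 (.replicate 5 4) :=
  graphicContaining_of_subset_path ∅ (by decide) (by decide)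

theorem IsMinLayoff.pos_of_mem (h : IsMinLayoff A B) (h2 : 2 ≤ (adjoinDegree A B).countP (2 ≤ ·)) :
    ∀ x ∈ A + B, 1 ≤ x := by
  intro x hx
  by_contra! hx0
  obtain rfl : x = 0 := by omega
  have hcard := Multiset.card_pos.2 h.ne_zero
  rcases Multiset.mem_add.1 hx with hA | hB
  · have hA1 : A.card = 1 := by have := h.card_le_left 0 hA; omega
    obtain ⟨y, rfl⟩ := Multiset.card_eq_one.1 hA1
    obtain rfl := Multiset.mem_singleton.1 hA
    have : B.countP (2 ≤ ·) = 0 := (countP_eq_zero_iff_le B 1).2 (h.le_add_one 0 hA)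
    simp [adjoinDegree, this] at h2
  · have := h.card_le_right 0 hB
    omega

theorem graphicContaining_of_dominatesGem (h : GraphicMultiset M) (hpos : ∀ x ∈ M, 1 ≤ x)
    (hdom : DominatesGem M) (hexc : ¬ IsExceptional M) : GraphicContaining K5MinusP3 M := by
  induction hn : M.card using Nat.strong_induction_on generalizing M with
  | _ n ih =>
    have hne : M ≠ 0 := by
      rintro rfl
      simp [DominatesGem] at hdom
    obtain ⟨A, B, rfl, hlay, hAB⟩ := h.exists_isMinLayoff hne hpos
    have hpos' := hlay.pos_of_mem (by have := hdom.2.2; omega)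
    have hlt : ∀ x ∈ A + B, x < (A + B).card := fun x => hAB.lt_card
    obtain h4 | h4 := ((A + B).countP (4 ≤ ·)).eq_zero_or_pos
    · obtain ⟨hle, hK5 | hsmall⟩ := hlay.small_of_countP_four_eq_zero h4
      · exact hK5 ▸ graphicContaining_replicate_four
      · rw [le_min_iff] at hsmall
        exact graphicContaining_of_small h hle
          (fun x hx => ⟨hpos x hx, hsmall.2.trans (hlay.card_le x hx)⟩) hsmall.1 hdom hexc
    obtain h3 | h3 := Nat.lt_or_ge 2 ((A + B).countP (3 ≤ ·))
    · by_cases hE : IsExceptional (A + B)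
      · exact hlay.graphicContaining_of_isExceptional hE
      · have h2 := hlay.five_le_countP_two hdom.2.2 hlt h4 h3
        refine (ih _ ?_ hAB hpos' ⟨h4, h3, h2⟩ hE rfl).adjoin
        rw [← hn, card_adjoinDegree]
        exact Nat.lt_succ_self _
    · obtain ⟨hA, hc5, hc4, hc3⟩ := hlay.one_large_of_countP_three_le hdom.2.1 hlt h4 h3
      obtain ⟨D, b, hD, hM⟩ := exists_eq_cons_smallDegrees hc5 hc4 hc3 (hA ▸ hlay.card_le)
      rw [hM] at h ⊢
      exact graphicContaining_of_one_large hD h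

end Sufficiency

section Sequences

theorem exists_equiv_of_map_univ_eq {V W α : Type*} [Fintype V] [Fintype W] {f : V → α}
    {g : W → α} (h : Finset.univ.val.map f = Finset.univ.val.map g) :
    ∃ e : V ≃ W, ∀ v, g (e v) = f v := by
  classical
  have fiberEquiv (c : α) : Nonempty ({v // f v = c} ≃ {w // g w = c}) := by
    have hcount := congrArg (Multiset.count c) h
    rw [Multiset.count_map, Multiset.count_map] at hcount
    refine ⟨Fintype.equivOfCardEq ?_⟩
    rw [Fintype.card_subtype, Fintype.card_subtype]
    simpa only [Finset.card, Finset.filter, eq_comm] using hcount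
  exact ⟨Equiv.ofFiberEquiv fun c => (fiberEquiv c).some, Equiv.ofFiberEquiv_map _⟩

variable {n : ℕ} {d : Fin n → ℕ}

theorem isRealization_iff (G : SimpleGraph (Fin n)) (d : Fin n → ℕ) :
    IsRealization G d ↔ degreeMultiset G = List.ofFn d := by
  rw [degreeMultiset, ← Fin.univ_val_map]
  simp only [IsRealization, ← vertexDegree_eq_degree]
  constructor
  · rintro ⟨σ, hσ⟩
    rw [← funext hσ]
    conv_lhs => rw [← Multiset.map_univ_val_equiv σ, Multiset.map_map]
    rfl
  · exact fun h => exists_equiv_of_map_univ_eq h.symm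

theorem potentiallyGraphic_iff {V : Type*} {H : SimpleGraph V} (d : Fin n → ℕ) :
    PotentiallyGraphic H d ↔ GraphicContaining H (List.ofFn d) := by
  simp only [PotentiallyGraphic, isRealization_iff]
  constructor
  · rintro ⟨G, hd, hG⟩
    exact ⟨n, G, hG, hd⟩
  · rintro ⟨m, G, hG, hd⟩
    obtain rfl : m = n := by simpa [card_degreeMultiset] using congrArg Multiset.card hd
    exact ⟨G, hd, hG⟩

theorem lt_countP_le_iff (hd : Antitone d) {k : ℕ} (hk : k < n) (t : ℕ) :
    k < (List.ofFn d : Multiset ℕ).countP (t ≤ ·) ↔ t ≤ d ⟨k, hk⟩ := by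
  rw [← Fin.univ_val_map, Multiset.countP_map]
  change k < (Finset.univ.filter fun i => t ≤ d i).card ↔ _
  constructor
  · contrapose!
    intro hlt
    refine (Finset.card_le_card (t := Finset.Iio ⟨k, hk⟩) fun i hi => ?_).trans (by simp)
    rw [Finset.mem_Iio]
    by_contra! hki
    exact ((Finset.mem_filter.1 hi).2.trans (hd hki)).not_gt hlt
  · intro hle
    refine (Nat.lt_succ_self k).trans_le <|
      le_trans (by simp) (Finset.card_le_card (s := Finset.Iic ⟨k, hk⟩) fun i hi => ?_)
    exact Finset.mem_filter.2 ⟨Finset.mem_univ _, hle.trans (hd (Finset.mem_Iic.1 hi))⟩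

theorem ofFn_eq_iff_coe_eq (hd : Antitone d) {l : List ℕ} (hl : l.SortedGE) :
    List.ofFn d = l ↔ (List.ofFn d : Multiset ℕ) = l :=
  ⟨congrArg _, fun h => (Multiset.coe_eq_coe.1 h).eq_of_sortedGE hd.sortedGE_ofFn hl⟩

theorem dominatesGem_ofFn_iff (hd : Antitone d) (hn : 4 < n) :
    DominatesGem (List.ofFn d) ↔
      4 ≤ d ⟨0, pos_of_gt hn⟩ ∧ 3 ≤ d ⟨2, hn.trans' (by decide)⟩ ∧ 2 ≤ d ⟨4, hn⟩ := by
  rw [DominatesGem, ← lt_countP_le_iff hd, ← lt_countP_le_iff hd, ← lt_countP_le_iff hd]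
  rfl

theorem isExceptional_ofFn_iff (hd : Antitone d) :
    IsExceptional (List.ofFn d) ↔
      List.ofFn d = [4, 3, 3, 2, 2, 2] ∨ List.ofFn d = [4, 3, 3, 2, 2, 2, 2] ∨
        List.ofFn d = [4, 3, 3, 3, 3, 3, 3] := by
  rw [ofFn_eq_iff_coe_eq hd (by decide), ofFn_eq_iff_coe_eq hd (by decide),
    ofFn_eq_iff_coe_eq hd (by decide)]
  rfl

end Sequences

theorem theorem3p1 (n : ℕ) (hn : 5 ≤ n) (d : Fin n → ℕ) (hd : IsGraphic d)
    (hpos : ∀ i, 1 ≤ d i) :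
    PotentiallyGraphic K5MinusP3 d ↔
      (4 ≤ d ⟨0, by omega⟩ ∧ 3 ≤ d ⟨2, by omega⟩ ∧ 2 ≤ d ⟨4, by omega⟩) ∧
      (List.ofFn d ≠ [4, 3, 3, 2, 2, 2] ∧
        List.ofFn d ≠ [4, 3, 3, 2, 2, 2, 2] ∧
        List.ofFn d ≠ [4, 3, 3, 3, 3, 3, 3]) := by
  obtain ⟨hanti, G, hG⟩ := hd
  have hgraphic : GraphicMultiset (List.ofFn d) := ⟨n, G, (isRealization_iff G d).1 hG⟩
  have hpos' : ∀ x ∈ (List.ofFn d : Multiset ℕ), 1 ≤ x := by simpa using hpos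
  simp only [ne_eq, ← not_or]
  rw [← dominatesGem_ofFn_iff hanti hn, ← isExceptional_ofFn_iff hanti, potentiallyGraphic_iff]
  constructor
  · exact fun h => ⟨h.dominatesGem, h.not_isExceptional⟩
  · exact fun ⟨hdom, hexc⟩ => graphicContaining_of_dominatesGem hgraphic hpos' hdom hexc
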